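/- **Setting.** Let $v_1,\dots,v_\mu\in\mathbb{R}^n$ be orthonormal, $\bar{\mathcal U}=\prod_{i=1}^{\mu}[\underline\alpha_i,\bar\alpha_i]$ a box with $\underline\alpha_i<\bar\alpha_i$, and $\mathcal U=\{\sum_i\bar u_i v_i:\bar u\in\bar{\mathcal U}\}$; for a hyperrectangle $\bar H\subseteq\bar{\mathcal U}$ (closed, with edges of positive length) write $H=\{\sum_i \bar u_iv_i:\bar u\in\bar H\}$. Let $\mathcal Y\subset\mathbb{R}^n$ be compact, let $N:\mathcal U\to\mathcal Y$ satisfy $\|N(u)-N(u')\|\le L\|u-u'\|$ for all $u,u'\in\mathcal U$ with a known $L>0$ (Euclidean norms), let $G:\mathbb{R}^n\to\mathbb{R}^n$ be a fixed linear model, and let $\epsilon>0$ be such that some $u\in\mathcal U$ has $\|u\|\ge\epsilon$. The AE-NLM of $N$ for $G$ is $$\Phi^{\mathcal U,G}_{\rm AE}=\max_{u\in\mathcal U,\ \|u\|\ge\epsilon}\frac{\|N(u)-G(u)\|}{\|u\|}.$$ For a finite set $D$ of at least two noise-free samples $(u,N(u))$, $u\in\mathcal U$, the local inference on $\bar H$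 is $$\max\Big\{\tfrac{\|y-G(u)\|}{\|u\|}:\ u\in H,\ \|u\|\ge\epsilon,\ y\in\mathcal Y,\ \|y-y'\|\le L\|u-u'\|,\ \|y-y''\|\le L\|u-u''\|\Big\},$$ where $(u',y')\ne(u'',y'')$ are two samples of $D$ whose inputs are closest to $H$ (ties broken arbitrarily). A maximizing $u$ is called a worst-case input. Hyperrectangles without inputs of norm at least $\epsilon$ have no local inference and are never selected. **Algorithm.** Fix $\alpha>0$. Start with a finite set of at least two noise-free samples and a finite partition of $\bar{\mathcal U}$ into hyperrectangles (with disjoint interiors), and compute a local inference and the amplitudes of a worst-case input for each hyperrectangle. In iteration $k=0,1,2,\dots$: 1. Select a hyperrectangle $\bar H$ with the largest (saturated) local inference and call that value $\Phi^{\mathcal U,G}_{\rm AE}(k)$; let $\bar u^*\in\bar H$ be its worst-case amplitudes. 2. Divide $\bar H$ into two hyperrectangles $\bar H^1,\bar H^2$ by a hyperplane orthogonal to a largest edge of $\bar H$. The hyperplane passes through $\bar c=\bar u^*$ if the resulting parts satisfy $1/\alpha<\operatorname{vol}(\bar H^1)/\operatorname{vol}(\bar H^2)<\alpha$, and otherwise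 through the middle point $\bar c$ of $\bar H$. 3. Add the noise-free sample $(c,N(c))$ with $c=\sum_i\bar c_iv_i$ to the data. 4. Compute the local inferences (and worst-case inputs) of $\bar H^1$ and $\bar H^2$ from the enlarged data, and saturate each value by that of $\bar H$, i.e. replace it by its minimum with the value of $\bar H$. Replace $\bar H$ by $\bar H^1,\bar H^2$ in the partition; all other hyperrectangles keep their values and worst-case inputs. **Theorem (Convergence).** For every run of this algorithm, i.e. for all choices it leaves open, the maximum defining $\Phi^{\mathcal U,G}_{\rm AE}$ is attained, the sequence $\Phi^{\mathcal U,G}_{\rm AE}(k)$ is non-increasing, $\Phi^{\mathcal U,G}_{\rm AE}(k)\ge\Phi^{\mathcal U,G}_{\rm AE}$ for all $k$, and $$\lim_{k\to\infty}\Phi^{\mathcal U,G}_{\rm AE}(k)=\Phi^{\mathcal U,G}_{\rm AE}.$$ -/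

import Mathlib

namespace AENLM

/-- Input and output trajectories of length `n`, with the Euclidean norm. -/
abbrev Traj (n : ℕ) : Type := EuclideanSpace ℝ (Fin n)

/-- A closed hyperrectangle of amplitudes in `ℝ^m` with edges of positive length; as a set it is
always used through `Box.Icc`, the closed box. -/
abbrev Rect (m : ℕ) : Type := BoxIntegral.Box (Fin m)

/-- The data of the problem (no property is assumed here). -/
structure Setup (m n : ℕ) where
  /-- the basis signals `v_1, …, v_m` that span the inputs -/
  signal : Fin m → Traj n
  /-- the box of admissible amplitudes -/
  ampBox : Rect m
  /-- the output set `𝒴` -/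
  outputs : Set (Traj n)
  /-- the plant `N`; only its values on the input set matter -/
  plant : Traj n → Traj n
  /-- the linear model `G` -/
  model : Traj n →ₗ[ℝ] Traj n
  /-- the Lipschitz constant `L` -/
  lip : ℝ
  /-- inputs of norm smaller than `ε` are excluded -/
  eps : ℝ
  /-- the parameter `α` that bounds the ratio of the volumes in a split -/
  ratioBound : ℝ

variable {m n : ℕ}

/-- The input with amplitudes `a`: the signal `∑ a_i v_i`. -/
noncomputable def Setup.input (S : Setup m n) (a : Fin m → ℝ) : Traj n :=
  ∑ i, a i • S.signal i

/-- The inputs whose amplitudes lie in the closed hyperrectangle `H`. -/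
def Setup.inputsOf (S : Setup m n) (H : Rect m) : Set (Traj n) :=
  S.input '' (BoxIntegral.Box.Icc H)

/-- The input set `𝒰`. -/
def Setup.inputs (S : Setup m n) : Set (Traj n) :=
  S.inputsOf S.ampBox

/-- The error of the linear model at an input-output pair, relative to the size of the input. -/
noncomputable def Setup.relError (S : Setup m n) (p : Traj n × Traj n) : ℝ :=
  ‖p.2 - S.model p.1‖ / ‖p.1‖

/-- The relative errors `‖N(u) - G(u)‖ / ‖u‖` over all inputs `u ∈ 𝒰` with `‖u‖ ≥ ε`. -/
def Setup.plantErrors (S : Setup m n) : Set ℝ :=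
  {r | ∃ u ∈ S.inputs, S.eps ≤ ‖u‖ ∧ r = S.relError (u, S.plant u)}

/-- The true AE-NLM of the plant for the fixed linear model `G`. -/
noncomputable def Setup.aeNLM (S : Setup m n) : ℝ :=
  sSup S.plantErrors

/-- The envelope of a set `D` of input-output samples. -/
def Setup.envelope (S : Setup m n) (D : Set (Traj n × Traj n)) : Set (Traj n × Traj n) :=
  {p | p.1 ∈ S.inputs ∧ p.2 ∈ S.outputs ∧ ∀ s ∈ D, ‖p.2 - s.2‖ ≤ S.lip * ‖p.1 - s.1‖}

/-- The hyperrectangle `H` contains an input that is not excluded. The maximum that defines the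
local inference of `H` is over a nonempty set only in this case; other hyperrectangles have no
local inference (a maximum over the empty set, that is `-∞`) and are never selected. -/
def Setup.Relevant (S : Setup m n) (H : Rect m) : Prop :=
  ∃ u ∈ S.inputsOf H, S.eps ≤ ‖u‖

/-- `s` and `t` are two samples of `D` whose inputs are closest to the inputs of `H`
(ties may be broken in any way). -/
def Setup.IsClosestPair (S : Setup m n) (D : Set (Traj n × Traj n)) (H : Rect m)
    (s t : Traj n × Traj n) : Prop :=
  s ∈ D ∧ t ∈ D ∧ s ≠ t ∧ ∀ r ∈ D, r ≠ s → r ≠ t →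
    Metric.infDist s.1 (S.inputsOf H) ≤ Metric.infDist r.1 (S.inputsOf H) ∧
    Metric.infDist t.1 (S.inputsOf H) ≤ Metric.infDist r.1 (S.inputsOf H)

/-- The feasible set of the local inference on `H` from the samples `s` and `t`. -/
def Setup.localFeasible (S : Setup m n) (H : Rect m) (s t : Traj n × Traj n) :
    Set (Traj n × Traj n) :=
  {p | p ∈ S.envelope {s, t} ∧ p.1 ∈ S.inputsOf H ∧ S.eps ≤ ‖p.1‖}

/-- `r` is the local AE-NLM inference on `H` from two samples of `D` closest to `H`, and `a` are
the amplitudes of a worst-case input, at which this maximum is attained. -/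
def Setup.IsLocalInference (S : Setup m n) (D : Set (Traj n × Traj n)) (H : Rect m)
    (r : ℝ) (a : Fin m → ℝ) : Prop :=
  ∃ s t, S.IsClosestPair D H s t ∧
    a ∈ BoxIntegral.Box.Icc H ∧
    (∃ y, (S.input a, y) ∈ S.localFeasible H s t ∧ S.relError (S.input a, y) = r) ∧
    ∀ p ∈ S.localFeasible H s t, S.relError p ≤ r

/-- The middle point of a hyperrectangle. -/
noncomputable def center (H : Rect m) : Fin m → ℝ :=
  fun j => (H.lower j + H.upper j) / 2

/-- The `i`-th edge of `H` is a largest one. -/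
def IsLargestEdge (H : Rect m) (i : Fin m) : Prop :=
  ∀ j, H.upper j - H.lower j ≤ H.upper i - H.lower i

/-- The volume of the box with corners `a ≤ b`. -/
noncomputable def boxVol (a b : Fin m → ℝ) : ℝ := ∏ j, (b j - a j)

/-- The ratio of the volumes of the two parts into which the hyperplane of all `z` with `z i = x`
divides `H`. -/
noncomputable def splitRatio (H : Rect m) (i : Fin m) (x : ℝ) : ℝ :=
  boxVol H.lower (Function.update H.upper i x) / boxVol (Function.update H.lower i x) H.upper

/-- `H₁` and `H₂` are the two parts into which the hyperplane of all `z` with `z i = x`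
divides `H`. -/
def IsSplit (H : Rect m) (i : Fin m) (x : ℝ) (H₁ H₂ : Rect m) : Prop :=
  H₁.lower = H.lower ∧ H₁.upper = Function.update H.upper i x ∧
  H₂.lower = Function.update H.lower i x ∧ H₂.upper = H.upper

open Classical in
/-- The point through which `H` is divided across its `i`-th edge, and at which the plant is
sampled: the worst-case amplitudes `a` if the ratio of the volumes of the resulting parts lies
strictly between `1 / α` and `α`, and the middle point of `H` otherwise. -/
noncomputable def Setup.splitPoint (S : Setup m n) (H : Rect m) (i : Fin m) (a : Fin m → ℝ) :
    Fin m → ℝ :=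
  if 1 / S.ratioBound < splitRatio H i (a i) ∧ splitRatio H i (a i) < S.ratioBound then a
  else center H

/-- The state of the iterative scheme. The values of `bound` and `worst` matter only on the
current relevant hyperrectangles. -/
structure State (m n : ℕ) where
  /-- the input-output samples -/
  samples : Set (Traj n × Traj n)
  /-- the current partition of the amplitude box -/
  cells : Set (Rect m)
  /-- the (saturated) local inferences -/
  bound : Rect m → ℝ
  /-- the amplitudes of the worst-case inputs -/
  worst : Rect m → Fin m → ℝ

/-- Initial state: samples `D`, initial partition `P`, local inferences computed from `D`. -/
structure Setup.IsInitial (S : Setup m n) (P : BoxIntegral.Prepartition S.ampBox)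
    (D : Set (Traj n × Traj n)) (σ : State m n) : Prop where
  samples_eq : σ.samples = D
  cells_eq : σ.cells = {H | H ∈ P}
  inference : ∀ H ∈ σ.cells, S.Relevant H →
    S.IsLocalInference D H (σ.bound H) (σ.worst H)

/-- `H` is a current hyperrectangle with the largest (saturated) local inference. -/
structure Setup.IsSelected (S : Setup m n) (σ : State m n) (H : Rect m) : Prop where
  mem : H ∈ σ.cells
  relevant : S.Relevant H
  largest : ∀ K ∈ σ.cells, S.Relevant K → σ.bound K ≤ σ.bound H

/-- One iteration from `σ` to `τ`, in which `H` is divided: `H` is divided across a largest edge,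
the plant is sampled at the split point, the local inferences of the two parts are computed from
the enlarged set of samples and saturated by that of `H`; nothing else changes. -/
def Setup.IsStep (S : Setup m n) (σ : State m n) (H : Rect m) (τ : State m n) : Prop :=
  ∃ (i : Fin m) (c : Fin m → ℝ) (H₁ H₂ : Rect m),
    IsLargestEdge H i ∧
    c = S.splitPoint H i (σ.worst H) ∧
    IsSplit H i (c i) H₁ H₂ ∧
    τ.samples = insert (S.input c, S.plant (S.input c)) σ.samples ∧
    τ.cells = (σ.cells \ {H}) ∪ {H₁, H₂} ∧
    (∀ K ∈ σ.cells, K ≠ H → τ.bound K = σ.bound K ∧ τ.worst K = σ.worst K) ∧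
    (∀ K ∈ ({H₁, H₂} : Set (Rect m)), S.Relevant K →
      ∃ r, S.IsLocalInference τ.samples K r (τ.worst K) ∧ τ.bound K = min r (σ.bound H))

/-- A run of the iterative scheme: `σ k` is the state and `H k` the selected hyperrectangle at
iteration `k`. -/
structure Setup.IsRun (S : Setup m n) (P : BoxIntegral.Prepartition S.ampBox)
    (D : Set (Traj n × Traj n)) (σ : ℕ → State m n) (H : ℕ → Rect m) : Prop where
  init : S.IsInitial P D (σ 0)
  select : ∀ k, S.IsSelected (σ k) (H k)
  step : ∀ k, S.IsStep (σ k) (H k) (σ (k + 1))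

/-- The sequence of global inferences: the largest local inference at each iteration. -/
def globalInference (σ : ℕ → State m n) (H : ℕ → Rect m) (k : ℕ) : ℝ :=
  (σ k).bound (H k)

end AENLM

/-! Upper bounds: for noise-free samples, `(u, N u)` satisfies every Lipschitz constraint, so a
local inference dominates the true errors on its cell. Saturation keeps this valid, since the
parent's bound already holds on the children, and makes the largest bound non-increasing. The cells
cover the box, so the largest bound is at least the AE-NLM.

Convergence: the split point lies on the face shared by both children, so every cell created by a
split contains a sample, and its bound exceeds the AE-NLM by at most a constant times the sum of its
edges (`bound_le_of_notMem_initial`). By monotonicity it then suffices that cells with arbitrarily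
short edges get selected (`exists_edges_lt`). Otherwise every selected cell would have an edge of
length at least some `d > 0`; the volume test then keeps all edges above a fixed length, and each
split lowers the sum of squared volumes by a fixed amount, which cannot go on forever. -/

namespace AENLM

variable {m n : ℕ}

/-- The standing assumptions on a problem, except for the compactness of the output set. -/
structure Setup.Admissible (S : Setup m n) : Prop where
  norm_signal : ∀ i, ‖S.signal i‖ = 1
  mapsTo : Set.MapsTo S.plant S.inputs S.outputs
  lip_pos : 0 < S.lip
  lipschitz : ∀ u ∈ S.inputs, ∀ u' ∈ S.inputs, ‖S.plant u - S.plant u'‖ ≤ S.lip * ‖u - u'‖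
  eps_pos : 0 < S.eps
  nonempty : ∃ u ∈ S.inputs, S.eps ≤ ‖u‖
  ratio_pos : 0 < S.ratioBound

/-! ### Compactness of the input set and attainment of the AE-NLM. -/

section Inputs

theorem Setup.continuous_input (S : Setup m n) : Continuous S.input := by
  unfold Setup.input
  fun_prop

theorem Setup.isCompact_inputsOf (S : Setup m n) (K : Rect m) : IsCompact (S.inputsOf K) :=
  (BoxIntegral.Box.isCompact_Icc K).image S.continuous_input

theorem Setup.inputsOf_subset (S : Setup m n) {K : Rect m} (h : K ≤ S.ampBox) :
    S.inputsOf K ⊆ S.inputs :=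
  Set.image_mono (BoxIntegral.Box.Icc.monotone h)

theorem mem_Icc_iff {K : Rect m} {a : Fin m → ℝ} :
    a ∈ BoxIntegral.Box.Icc K ↔ ∀ i, K.lower i ≤ a i ∧ a i ≤ K.upper i := by
  rw [BoxIntegral.Box.Icc_def, Set.mem_Icc, Pi.le_def, Pi.le_def, forall_and]

theorem Setup.Admissible.norm_sub_le {S : Setup m n} (hS : S.Admissible) {K : Rect m}
    {u u' : Traj n} (hu : u ∈ S.inputsOf K) (hu' : u' ∈ S.inputsOf K) :
    ‖u - u'‖ ≤ ∑ i, (K.upper i - K.lower i) := by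
  obtain ⟨a, ha, rfl⟩ := hu
  obtain ⟨b, hb, rfl⟩ := hu'
  rw [mem_Icc_iff] at ha hb
  unfold Setup.input
  rw [← Finset.sum_sub_distrib]
  refine (norm_sum_le _ _).trans (Finset.sum_le_sum fun i _ => ?_)
  rw [← sub_smul, norm_smul, hS.norm_signal, mul_one, Real.norm_eq_abs, abs_le]
  constructor <;> linarith [(ha i).1, (ha i).2, (hb i).1, (hb i).2]

theorem Setup.Admissible.continuousOn_plant {S : Setup m n} (hS : S.Admissible) :
    ContinuousOn S.plant S.inputs := by
  refine LipschitzOnWith.continuousOn (K := ⟨S.lip, hS.lip_pos.le⟩)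
    (LipschitzOnWith.of_dist_le_mul fun u hu u' hu' => ?_)
  rw [dist_eq_norm, dist_eq_norm]
  exact hS.lipschitz u hu u' hu'

theorem Setup.Admissible.isGreatest_aeNLM {S : Setup m n} (hS : S.Admissible) :
    IsGreatest S.plantErrors S.aeNLM := by
  have hset : S.plantErrors
      = (fun u => S.relError (u, S.plant u)) '' (S.inputs ∩ {u | S.eps ≤ ‖u‖}) := by
    ext r
    constructor
    · rintro ⟨u, hu, h, rfl⟩
      exact ⟨u, ⟨hu, h⟩, rfl⟩
    · rintro ⟨u, ⟨hu, h⟩, rfl⟩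
      exact ⟨u, hu, h, rfl⟩
  have hcomp : IsCompact (S.inputs ∩ {u | S.eps ≤ ‖u‖}) :=
    (S.isCompact_inputsOf S.ampBox).inter_right (isClosed_le continuous_const continuous_norm)
  have hcont : ContinuousOn (fun u => S.relError (u, S.plant u))
      (S.inputs ∩ {u | S.eps ≤ ‖u‖}) := by
    unfold Setup.relError
    refine ContinuousOn.div ?_ continuous_norm.continuousOn fun u hu => ?_
    · exact ((hS.continuousOn_plant.mono Set.inter_subset_left).sub
        S.model.continuous_of_finiteDimensional.continuousOn).norm
    · exact (hS.eps_pos.trans_le hu.2).ne'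
  have hne : S.plantErrors.Nonempty := by
    obtain ⟨u, hu, h⟩ := hS.nonempty
    exact ⟨_, u, hu, h, rfl⟩
  have hc : IsCompact S.plantErrors := hset ▸ hcomp.image_of_continuousOn hcont
  exact hc.isGreatest_sSup hne

theorem Setup.Admissible.relError_le_aeNLM {S : Setup m n} (hS : S.Admissible) {u : Traj n}
    (hu : u ∈ S.inputs) (h : S.eps ≤ ‖u‖) : S.relError (u, S.plant u) ≤ S.aeNLM :=
  hS.isGreatest_aeNLM.2 ⟨u, hu, h, rfl⟩

end Inputs

/-! ### Geometry of a split. -/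

section Splits

theorem center_mem_Icc (K : Rect m) : center K ∈ BoxIntegral.Box.Icc K := by
  rw [mem_Icc_iff]
  intro i
  have := K.lower_lt_upper i
  unfold center
  constructor <;> linarith

theorem Setup.splitPoint_mem_Icc (S : Setup m n) {K : Rect m} {a : Fin m → ℝ}
    (ha : a ∈ BoxIntegral.Box.Icc K) (i : Fin m) : S.splitPoint K i a ∈ BoxIntegral.Box.Icc K := by
  unfold Setup.splitPoint
  split_ifs
  exacts [ha, center_mem_Icc K]

theorem boxVol_update_upper (a b : Fin m → ℝ) (i : Fin m) (x : ℝ) :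
    boxVol a (Function.update b i x) = (x - a i) * ∏ j ∈ Finset.univ \ {i}, (b j - a j) := by
  unfold boxVol
  rw [← Finset.prod_update_of_mem (Finset.mem_univ i) (fun j => b j - a j) (x - a i)]
  refine Finset.prod_congr rfl fun j _ => ?_
  by_cases h : j = i
  · subst h; simp
  · simp [h]

theorem boxVol_update_lower (a b : Fin m → ℝ) (i : Fin m) (x : ℝ) :
    boxVol (Function.update a i x) b = (b i - x) * ∏ j ∈ Finset.univ \ {i}, (b j - a j) := by
  unfold boxVol
  rw [← Finset.prod_update_of_mem (Finset.mem_univ i) (fun j => b j - a j) (b i - x)]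
  refine Finset.prod_congr rfl fun j _ => ?_
  by_cases h : j = i
  · subst h; simp
  · simp [h]

theorem boxVol_eq_mul (a b : Fin m → ℝ) (i : Fin m) :
    boxVol a b = (b i - a i) * ∏ j ∈ Finset.univ \ {i}, (b j - a j) := by
  simpa using boxVol_update_upper a b i (b i)

/-- The other edges cancel, so the volume test constrains only the divided edge. -/
theorem splitRatio_eq (K : Rect m) (i : Fin m) (x : ℝ) :
    splitRatio K i x = (x - K.lower i) / (K.upper i - x) := by
  unfold splitRatio
  rw [boxVol_update_upper, boxVol_update_lower, mul_div_mul_right]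
  exact (Finset.prod_pos fun j _ => sub_pos.2 (K.lower_lt_upper j)).ne'

namespace IsSplit

variable {K K₁ K₂ : Rect m} {i : Fin m} {x : ℝ}

theorem lower_lt (h : IsSplit K i x K₁ K₂) : K.lower i < x := by
  have := K₁.lower_lt_upper i
  rwa [h.1, h.2.1, Function.update_self] at this

theorem lt_upper (h : IsSplit K i x K₁ K₂) : x < K.upper i := by
  have := K₂.lower_lt_upper i
  rwa [h.2.2.1, h.2.2.2, Function.update_self] at this

theorem le_left (h : IsSplit K i x K₁ K₂) : K₁ ≤ K := by
  rw [BoxIntegral.Box.le_iff_bounds, h.1, h.2.1]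
  exact ⟨le_rfl, update_le_self_iff.2 h.lt_upper.le⟩

theorem le_right (h : IsSplit K i x K₁ K₂) : K₂ ≤ K := by
  rw [BoxIntegral.Box.le_iff_bounds, h.2.2.1, h.2.2.2]
  exact ⟨le_update_self_iff.2 h.lower_lt.le, le_rfl⟩

theorem mem_left (h : IsSplit K i x K₁ K₂) {a : Fin m → ℝ} (ha : a ∈ BoxIntegral.Box.Icc K)
    (hx : a i ≤ x) : a ∈ BoxIntegral.Box.Icc K₁ := by
  rw [BoxIntegral.Box.Icc_def] at ha ⊢
  rw [h.1, h.2.1]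
  exact ⟨ha.1, le_update_iff.2 ⟨hx, fun j _ => ha.2 j⟩⟩

theorem mem_right (h : IsSplit K i x K₁ K₂) {a : Fin m → ℝ} (ha : a ∈ BoxIntegral.Box.Icc K)
    (hx : x ≤ a i) : a ∈ BoxIntegral.Box.Icc K₂ := by
  rw [BoxIntegral.Box.Icc_def] at ha ⊢
  rw [h.2.2.1, h.2.2.2]
  exact ⟨update_le_iff.2 ⟨hx, fun j _ => ha.1 j⟩, ha.2⟩

theorem boxVol_add (h : IsSplit K i x K₁ K₂) :
    boxVol K₁.lower K₁.upper + boxVol K₂.lower K₂.upper = boxVol K.lower K.upper := by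
  rw [h.1, h.2.1, h.2.2.1, h.2.2.2, boxVol_update_upper, boxVol_update_lower,
    boxVol_eq_mul K.lower K.upper i]
  ring

end IsSplit

/-- The guaranteed fraction of the divided edge that is left to each part in a split. -/
noncomputable def Setup.minFraction (S : Setup m n) : ℝ := min (1 / 2) (1 / (1 + S.ratioBound))

theorem Setup.Admissible.minFraction_pos {S : Setup m n} (hS : S.Admissible) :
    0 < S.minFraction := by
  have := hS.ratio_pos
  unfold Setup.minFraction
  positivity

theorem Setup.minFraction_le_one (S : Setup m n) : S.minFraction ≤ 1 :=
  (min_le_left _ _).trans (by norm_num)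

/-- If the lengths `p`, `q` of the two pieces satisfy `1 / α < p / q < α`, each exceeds `(p + q) /
(1 + α)`; the middle point leaves one half. -/
theorem Setup.Admissible.minFraction_mul_le {S : Setup m n} (hS : S.Admissible) {K K₁ K₂ : Rect m}
    {i : Fin m} {a : Fin m → ℝ} (h : IsSplit K i (S.splitPoint K i a i) K₁ K₂) :
    S.minFraction * (K.upper i - K.lower i) ≤ S.splitPoint K i a i - K.lower i ∧
      S.minFraction * (K.upper i - K.lower i) ≤ K.upper i - S.splitPoint K i a i := by
  have hlen : 0 < K.upper i - K.lower i := sub_pos.2 (K.lower_lt_upper i)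
  have hα := hS.ratio_pos
  have h1 := h.lower_lt
  have h2 := h.lt_upper
  unfold Setup.splitPoint at h1 h2 ⊢
  split_ifs at h1 h2 ⊢ with hc
  · have hle : S.minFraction * (K.upper i - K.lower i)
        ≤ 1 / (1 + S.ratioBound) * (K.upper i - K.lower i) :=
      mul_le_mul_of_nonneg_right (min_le_right _ _) hlen.le
    rw [splitRatio_eq, div_lt_div_iff₀ hα (by linarith), div_lt_iff₀ (by linarith)] at hc
    constructor <;> refine hle.trans ?_ <;>
      rw [one_div, inv_mul_le_iff₀ (by linarith)] <;> nlinarith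
  · have hle : S.minFraction * (K.upper i - K.lower i) ≤ 1 / 2 * (K.upper i - K.lower i) :=
      mul_le_mul_of_nonneg_right (min_le_left _ _) hlen.le
    unfold center
    constructor <;> linarith

/-- If a largest edge of the divided cell is at least `d`, then the edges of the parts are bounded
below in terms of `d` whenever those of the divided cell are. -/
theorem Setup.Admissible.minFraction_mul_le_edge {S : Setup m n} (hS : S.Admissible)
    {K K₁ K₂ : Rect m} {i : Fin m} {a : Fin m → ℝ} {d : ℝ}
    (h : IsSplit K i (S.splitPoint K i a i) K₁ K₂)
    (hi : d ≤ K.upper i - K.lower i)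
    (hK : ∀ j, S.minFraction * d ≤ K.upper j - K.lower j) :
    ∀ K' ∈ ({K₁, K₂} : Set (Rect m)), ∀ j, S.minFraction * d ≤ K'.upper j - K'.lower j := by
  have hd := mul_le_mul_of_nonneg_left hi hS.minFraction_pos.le
  have hf := hS.minFraction_mul_le h
  rintro K' (rfl | rfl) j
  · rw [h.1, h.2.1]
    by_cases hj : j = i
    · subst hj
      rw [Function.update_self]
      exact hd.trans hf.1
    · rw [Function.update_of_ne hj]
      exact hK j
  · rw [h.2.2.1, h.2.2.2]
    by_cases hj : j = i
    · subst hj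
      rw [Function.update_self]
      exact hd.trans hf.2
    · rw [Function.update_of_ne hj]
      exact hK j

end Splits

/-! ### Validity and monotonicity of the bounds. -/

section Soundness

/-- The noise-free samples and cells of a state fit the problem, and its bounds are valid. -/
structure Setup.Sound (S : Setup m n) (σ : State m n) : Prop where
  sample : ∀ s ∈ σ.samples, s.1 ∈ S.inputs ∧ s.2 = S.plant s.1
  le_ampBox : ∀ K ∈ σ.cells, K ≤ S.ampBox
  cover : ∀ a ∈ BoxIntegral.Box.Icc S.ampBox, ∃ K ∈ σ.cells, a ∈ BoxIntegral.Box.Icc K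
  worst_mem : ∀ K ∈ σ.cells, S.Relevant K → σ.worst K ∈ BoxIntegral.Box.Icc K
  relError_le : ∀ K ∈ σ.cells, ∀ u ∈ S.inputsOf K, S.eps ≤ ‖u‖ →
    S.relError (u, S.plant u) ≤ σ.bound K

theorem Setup.IsLocalInference.mem_Icc {S : Setup m n} {D : Set (Traj n × Traj n)} {K : Rect m}
    {r : ℝ} {a : Fin m → ℝ} (h : S.IsLocalInference D K r a) : a ∈ BoxIntegral.Box.Icc K := by
  obtain ⟨s, t, -, ha, -⟩ := h
  exact ha

theorem Setup.IsLocalInference.relError_le {S : Setup m n} (hS : S.Admissible)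
    {D : Set (Traj n × Traj n)} (hD : ∀ s ∈ D, s.1 ∈ S.inputs ∧ s.2 = S.plant s.1) {K : Rect m}
    (hK : K ≤ S.ampBox) {r : ℝ} {a : Fin m → ℝ} (h : S.IsLocalInference D K r a) {u : Traj n}
    (hu : u ∈ S.inputsOf K) (hε : S.eps ≤ ‖u‖) : S.relError (u, S.plant u) ≤ r := by
  obtain ⟨s, t, hst, -, -, hmax⟩ := h
  have huU := S.inputsOf_subset hK hu
  refine hmax _ ⟨⟨huU, hS.mapsTo huU, ?_⟩, hu, hε⟩
  intro q hq
  have hqD : q ∈ D := by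
    rcases hq with rfl | rfl
    exacts [hst.1, hst.2.1]
  rw [(hD q hqD).2]
  exact hS.lipschitz u huU q.1 (hD q hqD).1

/-- If some sample lies in `K`, then so does one of two samples closest to `K`. -/
theorem Setup.IsClosestPair.exists_mem {S : Setup m n} {D : Set (Traj n × Traj n)} {K : Rect m}
    {s t : Traj n × Traj n} (h : S.IsClosestPair D K s t) {p : Traj n × Traj n} (hp : p ∈ D)
    (hpK : p.1 ∈ S.inputsOf K) : ∃ q ∈ ({s, t} : Set _), q ∈ D ∧ q.1 ∈ S.inputsOf K := by
  by_cases hs : p = s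
  · exact ⟨p, Or.inl hs, hp, hpK⟩
  by_cases ht : p = t
  · exact ⟨p, Or.inr ht, hp, hpK⟩
  -- A sample in `K` that was not chosen has distance zero, which forces distance zero for `s`; the
  -- set of inputs is closed.
  have hle := (h.2.2.2 p hp hs ht).1
  rw [Metric.infDist_zero_of_mem hpK] at hle
  refine ⟨s, Or.inl rfl, h.1, ?_⟩
  rw [(S.isCompact_inputsOf K).isClosed.mem_iff_infDist_zero ⟨_, hpK⟩]
  exact le_antisymm hle Metric.infDist_nonneg

/-- One of the two constraining samples has its input in `K`. Its output is within `lip` times the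
diameter of both the worst-case output `y` and the plant's output at the same input; hence the
factor 2. Dividing by `‖u‖ ≥ eps` gives the error term. -/
theorem Setup.IsLocalInference.le_aeNLM_add {S : Setup m n} (hS : S.Admissible)
    {D : Set (Traj n × Traj n)} (hD : ∀ s ∈ D, s.1 ∈ S.inputs ∧ s.2 = S.plant s.1) {K : Rect m}
    {r : ℝ} {a : Fin m → ℝ} (h : S.IsLocalInference D K r a)
    {p : Traj n × Traj n} (hp : p ∈ D) (hpK : p.1 ∈ S.inputsOf K) :
    r ≤ S.aeNLM + 2 * S.lip / S.eps * ∑ i, (K.upper i - K.lower i) := by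
  obtain ⟨s, t, hst, -, ⟨y, ⟨hy, huK, hε⟩, rfl⟩, -⟩ := h
  obtain ⟨q, hq, hqD, hqK⟩ := hst.exists_mem hp hpK
  set u := S.input a
  have huU : u ∈ S.inputs := hy.1
  have hdist := hS.norm_sub_le huK hqK
  have h1 : ‖y - q.2‖ ≤ S.lip * ‖u - q.1‖ := hy.2.2 q hq
  have h2 : ‖S.plant u - q.2‖ ≤ S.lip * ‖u - q.1‖ := by
    rw [(hD q hqD).2]
    exact hS.lipschitz u huU q.1 (hD q hqD).1
  have h3 : ‖y - S.plant u‖ ≤ 2 * S.lip * ∑ i, (K.upper i - K.lower i) := by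
    have h4 : ‖y - S.plant u‖ ≤ ‖y - q.2‖ + ‖S.plant u - q.2‖ := by
      have := norm_sub_le (y - q.2) (S.plant u - q.2)
      rwa [sub_sub_sub_cancel_right] at this
    have h5 := mul_le_mul_of_nonneg_left hdist hS.lip_pos.le
    linarith
  have hupos : 0 < ‖u‖ := hS.eps_pos.trans_le hε
  have hrel : S.relError (u, y) ≤ S.relError (u, S.plant u) + ‖y - S.plant u‖ / ‖u‖ := by
    unfold Setup.relError
    rw [← add_div]
    refine div_le_div_of_nonneg_right ?_ hupos.le
    have := norm_add_le (S.plant u - S.model u) (y - S.plant u)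
    rwa [show S.plant u - S.model u + (y - S.plant u) = y - S.model u by abel] at this
  have hdiv : ‖y - S.plant u‖ / ‖u‖ ≤ 2 * S.lip / S.eps * ∑ i, (K.upper i - K.lower i) := by
    rw [div_mul_eq_mul_div]
    exact div_le_div₀ ((norm_nonneg _).trans h3) h3 hS.eps_pos hε
  linarith [hS.relError_le_aeNLM huU hε]

/-- The partition covers only the half-open box; the finite union of closed cells is closed, so it
contains the closure too. -/
theorem exists_mem_Icc_of_isPartition {I : Rect m} {P : BoxIntegral.Prepartition I}
    (hP : P.IsPartition) {a : Fin m → ℝ} (ha : a ∈ BoxIntegral.Box.Icc I) :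
    ∃ K ∈ P, a ∈ BoxIntegral.Box.Icc K := by
  have hclosed : IsClosed (⋃ K ∈ P.boxes, BoxIntegral.Box.Icc K) :=
    P.boxes.finite_toSet.isClosed_biUnion fun K _ => (BoxIntegral.Box.isCompact_Icc K).isClosed
  have hsub : (I : Set (Fin m → ℝ)) ⊆ ⋃ K ∈ P.boxes, BoxIntegral.Box.Icc K := by
    intro z hz
    obtain ⟨K, hK, hzK⟩ := hP z hz
    exact Set.mem_biUnion hK (BoxIntegral.Box.coe_subset_Icc hzK)
  have hcl : a ∈ closure (I : Set (Fin m → ℝ)) := by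
    rw [BoxIntegral.Box.coe_eq_pi, closure_pi_set]
    intro i _
    beta_reduce
    rw [closure_Ioc (I.lower_lt_upper i).ne]
    exact mem_Icc_iff.1 ha i
  obtain ⟨K, hK, haK⟩ := Set.mem_iUnion₂.1 (closure_minimal hsub hclosed hcl)
  exact ⟨K, hK, haK⟩

variable {S : Setup m n} {P : BoxIntegral.Prepartition S.ampBox} {D : Set (Traj n × Traj n)}

theorem Setup.Admissible.sound_initial (hS : S.Admissible) (hP : P.IsPartition)
    (hD : ∀ s ∈ D, s.1 ∈ S.inputs ∧ s.2 = S.plant s.1) {σ : State m n}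
    (h : S.IsInitial P D σ) : S.Sound σ where
  sample := by rwa [h.samples_eq]
  le_ampBox K hK := P.le_of_mem (by simpa [h.cells_eq] using hK)
  cover a ha := by
    obtain ⟨K, hK, haK⟩ := exists_mem_Icc_of_isPartition hP ha
    exact ⟨K, by simpa [h.cells_eq] using hK, haK⟩
  worst_mem K hK hrel := (h.inference K hK hrel).mem_Icc
  relError_le K hK u hu hε :=
    (h.inference K hK ⟨u, hu, hε⟩).relError_le hS hD
      (P.le_of_mem (by simpa [h.cells_eq] using hK)) hu hε

theorem Setup.Sound.step (hS : S.Admissible) {σ τ : State m n} {H : Rect m} (hσ : S.Sound σ)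
    (hH : S.IsSelected σ H) (h : S.IsStep σ H τ) : S.Sound τ := by
  obtain ⟨i, c, H₁, H₂, -, hc, hsplit, hsamples, hcells, hold, hnew⟩ := h
  have hcH : c ∈ BoxIntegral.Box.Icc H :=
    hc ▸ S.splitPoint_mem_Icc (hσ.worst_mem H hH.mem hH.relevant) i
  have hHbox := hσ.le_ampBox H hH.mem
  have hchild : ∀ K ∈ ({H₁, H₂} : Set (Rect m)), K ≤ H := by
    rintro K (rfl | rfl)
    exacts [hsplit.le_left, hsplit.le_right]
  have hsample : ∀ s ∈ τ.samples, s.1 ∈ S.inputs ∧ s.2 = S.plant s.1 := by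
    rw [hsamples]
    rintro s (rfl | hs)
    · exact ⟨S.inputsOf_subset hHbox ⟨c, hcH, rfl⟩, rfl⟩
    · exact hσ.sample s hs
  have hbox : ∀ K ∈ τ.cells, K ≤ S.ampBox := by
    rw [hcells]
    rintro K (hK | hK)
    · exact hσ.le_ampBox K hK.1
    · exact (hchild K hK).trans hHbox
  refine ⟨hsample, hbox, ?_, ?_, ?_⟩
  · intro a ha
    obtain ⟨K, hK, haK⟩ := hσ.cover a ha
    rw [hcells]
    by_cases hKH : K = H
    · subst hKH
      rcases le_total (a i) (c i) with hle | hle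
      · exact ⟨H₁, Or.inr (Or.inl rfl), hsplit.mem_left haK hle⟩
      · exact ⟨H₂, Or.inr (Or.inr rfl), hsplit.mem_right haK hle⟩
    · exact ⟨K, Or.inl ⟨hK, hKH⟩, haK⟩
  · intro K hK hrel
    rw [hcells] at hK
    rcases hK with hK | hK
    · rw [(hold K hK.1 hK.2).2]
      exact hσ.worst_mem K hK.1 hrel
    · obtain ⟨r, hr, -⟩ := hnew K hK hrel
      exact hr.mem_Icc
  · intro K hK u hu hε
    have hKbox := hbox K hK
    rw [hcells] at hK
    rcases hK with hK | hK
    · rw [(hold K hK.1 hK.2).1]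
      exact hσ.relError_le K hK.1 u hu hε
    · obtain ⟨r, hr, hb⟩ := hnew K hK ⟨u, hu, hε⟩
      rw [hb]
      exact le_min (hr.relError_le hS hsample hKbox hu hε)
        (hσ.relError_le H hH.mem u
          (Set.image_mono (BoxIntegral.Box.Icc.monotone (hchild K hK)) hu) hε)

variable {σ : ℕ → State m n} {H : ℕ → Rect m}

theorem Setup.Admissible.sound_run (hS : S.Admissible) (hP : P.IsPartition)
    (hD : ∀ s ∈ D, s.1 ∈ S.inputs ∧ s.2 = S.plant s.1) (h : S.IsRun P D σ H) (k : ℕ) :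
    S.Sound (σ k) := by
  induction k with
  | zero => exact hS.sound_initial hP hD h.init
  | succ k ih => exact ih.step hS (h.select k) (h.step k)

theorem Setup.Sound.aeNLM_le (hS : S.Admissible) {τ : State m n} (hτ : S.Sound τ) {K : Rect m}
    (hK : S.IsSelected τ K) : S.aeNLM ≤ τ.bound K := by
  obtain ⟨u, ⟨a, ha, rfl⟩, hε, hr⟩ := hS.isGreatest_aeNLM.1
  obtain ⟨K', hK', haK'⟩ := hτ.cover a ha
  have hmem : S.input a ∈ S.inputsOf K' := ⟨a, haK', rfl⟩
  rw [hr]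
  exact (hτ.relError_le K' hK' _ hmem hε).trans (hK.largest K' hK' ⟨_, hmem, hε⟩)

theorem antitone_globalInference (h : S.IsRun P D σ H) : Antitone (globalInference σ H) := by
  refine antitone_nat_of_succ_le fun k => ?_
  obtain ⟨i, c, H₁, H₂, -, -, -, -, hcells, hold, hnew⟩ := h.step k
  have hsel := h.select (k + 1)
  have hmem := hsel.mem
  rw [hcells] at hmem
  unfold globalInference
  rcases hmem with hK | hK
  · rw [(hold _ hK.1 hK.2).1]
    exact (h.select k).largest _ hK.1 hsel.relevant
  · obtain ⟨r, -, hb⟩ := hnew _ hK hsel.relevant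
    rw [hb]
    exact min_le_right _ _

end Soundness

/-! ### Shrinking cells and the limit. -/

section Convergence

variable {S : Setup m n} {P : BoxIntegral.Prepartition S.ampBox} {D : Set (Traj n × Traj n)}
  {σ : ℕ → State m n} {H : ℕ → Rect m}

/-- Initial cells are excluded because they need not contain a sample. Any other cell received its
bound when a split placed a sample in it, and keeps that bound until it is divided. -/
theorem Setup.Admissible.bound_le_of_notMem_initial (hS : S.Admissible) (hP : P.IsPartition)
    (hD : ∀ s ∈ D, s.1 ∈ S.inputs ∧ s.2 = S.plant s.1) (h : S.IsRun P D σ H) (k : ℕ)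
    {K : Rect m} (hK : K ∈ (σ k).cells) (hrel : S.Relevant K) (hKP : K ∉ P) :
    (σ k).bound K ≤ S.aeNLM + 2 * S.lip / S.eps * ∑ i, (K.upper i - K.lower i) := by
  induction k with
  | zero => exact absurd (by simpa [h.init.cells_eq] using hK) hKP
  | succ k ih =>
    have hσ := hS.sound_run hP hD h k
    have hτ := hS.sound_run hP hD h (k + 1)
    obtain ⟨i, c, H₁, H₂, -, hc, hsplit, hsamples, hcells, hold, hnew⟩ := h.step k
    rw [hcells] at hK
    rcases hK with hK | hK
    · rw [(hold K hK.1 hK.2).1]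
      exact ih hK.1
    · obtain ⟨r, hr, hb⟩ := hnew K hK hrel
      have hcH : c ∈ BoxIntegral.Box.Icc (H k) :=
        hc ▸ S.splitPoint_mem_Icc (hσ.worst_mem _ (h.select k).mem (h.select k).relevant) i
      have hcK : c ∈ BoxIntegral.Box.Icc K := by
        rcases hK with rfl | rfl
        exacts [hsplit.mem_left hcH le_rfl, hsplit.mem_right hcH le_rfl]
      rw [hb]
      refine (min_le_left _ _).trans (hr.le_aeNLM_add hS hτ.sample
        (p := (S.input c, S.plant (S.input c))) ?_ ⟨c, hcK, rfl⟩)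
      rw [hsamples]
      exact Set.mem_insert _ _

theorem pow_le_boxVol {K : Rect m} {d : ℝ} (hd : 0 ≤ d) (h : ∀ j, d ≤ K.upper j - K.lower j) :
    d ^ m ≤ boxVol K.lower K.upper := by
  have := Finset.prod_le_prod (s := Finset.univ) (fun _ _ => hd) (fun j _ => h j)
  simpa [boxVol] using this

/-- The sum of the squared volumes of the cells decreases in each split, by at least a fixed amount
as long as the edges stay bounded below. -/
theorem Setup.Admissible.exists_sum_sq_boxVol_le (hS : S.Admissible) (h : S.IsRun P D σ H)
    {d : ℝ} (hd : 0 < d) (hinit : ∀ K ∈ P, ∀ j, d ≤ K.upper j - K.lower j)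
    (hsel : ∀ k, ∃ j, d ≤ (H k).upper j - (H k).lower j) (k : ℕ) :
    ∃ F : Finset (Rect m), (F : Set (Rect m)) = (σ k).cells ∧
      (∀ K ∈ F, ∀ j, S.minFraction * d ≤ K.upper j - K.lower j) ∧
      ∑ K ∈ F, boxVol K.lower K.upper ^ 2 + k * (2 * ((S.minFraction * d) ^ m) ^ 2)
        ≤ ∑ K ∈ P.boxes, boxVol K.lower K.upper ^ 2 := by
  classical
  have hη : 0 < S.minFraction * d := mul_pos hS.minFraction_pos hd
  induction k with
  | zero =>
    refine ⟨P.boxes, by rw [h.init.cells_eq]; rfl, fun K hK j => ?_, by simp⟩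
    exact (mul_le_of_le_one_left hd.le S.minFraction_le_one).trans (hinit K hK j)
  | succ k ih =>
    obtain ⟨F, hF, hedge, hsum⟩ := ih
    obtain ⟨i, c, H₁, H₂, hlargest, hc, hsplit, -, hcells, -, -⟩ := h.step k
    have hHF : H k ∈ F := by
      rw [← Finset.mem_coe, hF]
      exact (h.select k).mem
    have hi : d ≤ (H k).upper i - (H k).lower i := by
      obtain ⟨j, hj⟩ := hsel k
      exact hj.trans (hlargest j)
    have hchild := hS.minFraction_mul_le_edge (hc ▸ hsplit) hi (hedge _ hHF)
    refine ⟨F.erase (H k) ∪ {H₁, H₂}, ?_, ?_, ?_⟩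
    · rw [hcells, ← hF]
      simp
    · intro K hK
      rcases Finset.mem_union.1 hK with hK | hK
      · exact hedge K (Finset.mem_of_mem_erase hK)
      · exact hchild K (by simpa using hK)
    · have h1 := pow_le_boxVol hη.le (hchild H₁ (by simp))
      have h2 := pow_le_boxVol hη.le (hchild H₂ (by simp))
      have hpos : 0 < (S.minFraction * d) ^ m := pow_pos hη m
      have hprod : ((S.minFraction * d) ^ m) ^ 2
          ≤ boxVol H₁.lower H₁.upper * boxVol H₂.lower H₂.upper := by
        rw [sq]
        exact mul_le_mul h1 h2 hpos.le (hpos.le.trans h1)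
      -- A coincidence among the cells can only lower the sum of squares, so neither disjointness
      -- nor distinctness of the cells has to be tracked.
      have hU : ∑ K ∈ F.erase (H k) ∪ {H₁, H₂}, boxVol K.lower K.upper ^ 2
          ≤ ∑ K ∈ F.erase (H k), boxVol K.lower K.upper ^ 2
            + (boxVol H₁.lower H₁.upper ^ 2 + boxVol H₂.lower H₂.upper ^ 2) := by
        have hpair : ∑ K ∈ ({H₁, H₂} : Finset (Rect m)), boxVol K.lower K.upper ^ 2
            ≤ boxVol H₁.lower H₁.upper ^ 2 + boxVol H₂.lower H₂.upper ^ 2 := by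
          by_cases he : H₁ = H₂
          · subst he
            simp [sq_nonneg]
          · rw [Finset.sum_pair he]
        have hui := Finset.sum_union_inter (s₁ := F.erase (H k)) (s₂ := {H₁, H₂})
          (f := fun K : Rect m => boxVol K.lower K.upper ^ 2)
        have hnn : 0 ≤ ∑ K ∈ F.erase (H k) ∩ {H₁, H₂}, boxVol K.lower K.upper ^ 2 :=
          Finset.sum_nonneg fun _ _ => sq_nonneg _
        linarith
      have herase := Finset.add_sum_erase F (fun K : Rect m => boxVol K.lower K.upper ^ 2) hHF
      -- With `v = v₁ + v₂`, the split replaces `v ^ 2` by `v₁ ^ 2 + v₂ ^ 2`, a loss of `2 * v₁ *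
      -- v₂`.
      have hadd := congrArg (· ^ 2) hsplit.boxVol_add
      simp only [add_sq] at hadd
      push_cast
      linarith

/-- Cells with arbitrarily short edges are selected. -/
theorem Setup.Admissible.exists_edges_lt (hS : S.Admissible) (h : S.IsRun P D σ H)
    {d : ℝ} (hd : 0 < d) (hinit : ∀ K ∈ P, ∀ j, d ≤ K.upper j - K.lower j) :
    ∃ k, ∀ j, (H k).upper j - (H k).lower j < d := by
  by_contra! hsel
  have hpos : 0 < 2 * ((S.minFraction * d) ^ m) ^ 2 := by
    have := mul_pos hS.minFraction_pos hd
    positivity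
  obtain ⟨k, hk⟩ := exists_nat_gt
    ((∑ K ∈ P.boxes, boxVol K.lower K.upper ^ 2) / (2 * ((S.minFraction * d) ^ m) ^ 2))
  rw [div_lt_iff₀ hpos] at hk
  obtain ⟨F, -, -, hF⟩ := hS.exists_sum_sq_boxVol_le h hd hinit hsel k
  have hnn : 0 ≤ ∑ K ∈ F, boxVol K.lower K.upper ^ 2 := Finset.sum_nonneg fun _ _ => sq_nonneg _
  linarith

theorem exists_pos_le_edges {I : Rect m} (P : BoxIntegral.Prepartition I) :
    ∃ d > 0, ∀ K ∈ P, ∀ j, d ≤ K.upper j - K.lower j := by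
  have hev : ∀ᶠ d : ℝ in nhdsWithin 0 (Set.Ioi 0),
      ∀ K ∈ P.boxes, ∀ j, d ≤ K.upper j - K.lower j := by
    rw [Filter.eventually_all_finset]
    intro K _
    rw [Filter.eventually_all]
    intro j
    exact (Filter.Tendsto.mono_left Filter.tendsto_id nhdsWithin_le_nhds).eventually
      (eventually_le_nhds (sub_pos.2 (K.lower_lt_upper j)))
  obtain ⟨d, hd, hpos⟩ := (hev.and self_mem_nhdsWithin).exists
  exact ⟨d, hpos, hd⟩

theorem Setup.Admissible.exists_globalInference_lt (hS : S.Admissible) (hP : P.IsPartition)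
    (hD : ∀ s ∈ D, s.1 ∈ S.inputs ∧ s.2 = S.plant s.1) (h : S.IsRun P D σ H) {e : ℝ}
    (he : 0 < e) : ∃ k, globalInference σ H k < S.aeNLM + e := by
  obtain ⟨d₀, hd₀, hinit⟩ := exists_pos_le_edges P
  have hC : 0 < 2 * S.lip / S.eps := div_pos (mul_pos two_pos hS.lip_pos) hS.eps_pos
  have hM : 0 < 2 * S.lip / S.eps * (m + 1) := by positivity
  -- The first entry makes the selected cell shorter than any initial one; the second makes the
  -- error term less than `e`. Using `m + 1` instead of `m` avoids a zero denominator and makes the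
  -- inequality strict.
  have hd : 0 < min d₀ (e / (2 * S.lip / S.eps * (m + 1))) := lt_min hd₀ (div_pos he hM)
  obtain ⟨k, hk⟩ := hS.exists_edges_lt h hd fun K hK j => (min_le_left _ _).trans (hinit K hK j)
  -- The divided edge supplies an index, without which the edge bounds would be vacuous.
  obtain ⟨i, -⟩ := h.step k
  have hnot : H k ∉ P := fun hmem =>
    absurd (hinit _ hmem i) (not_le.2 ((hk i).trans_le (min_le_left _ _)))
  refine ⟨k, (hS.bound_le_of_notMem_initial hP hD h k (h.select k).mem (h.select k).relevant
    hnot).trans_lt ?_⟩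
  have hsum : ∑ j, ((H k).upper j - (H k).lower j)
      ≤ m * (e / (2 * S.lip / S.eps * (m + 1))) := by
    have := Finset.sum_le_sum (s := Finset.univ)
      fun j (_ : j ∈ Finset.univ) => ((hk j).trans_le (min_le_right _ _)).le
    simpa using this
  have hmul := mul_le_mul_of_nonneg_left hsum hC.le
  have hlt : 2 * S.lip / S.eps * (m * (e / (2 * S.lip / S.eps * (m + 1)))) < e := by
    have heq : 2 * S.lip / S.eps * (m * (e / (2 * S.lip / S.eps * (m + 1))))
        = e * (m / (m + 1)) := by
      generalize 2 * S.lip / S.eps = C at hC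
      field_simp
    rw [heq]
    refine mul_lt_of_lt_one_right he ?_
    rw [div_lt_one (by positivity)]
    linarith
  linarith

end Convergence

end AENLM

theorem theorem2 {m n : ℕ} (S : AENLM.Setup m n)
    (h_signal : Orthonormal ℝ S.signal)
    (h_outputs : IsCompact S.outputs)
    (h_plant : Set.MapsTo S.plant S.inputs S.outputs)
    (h_lip_pos : 0 < S.lip)
    (h_lip : ∀ u ∈ S.inputs, ∀ u' ∈ S.inputs,
      ‖S.plant u - S.plant u'‖ ≤ S.lip * ‖u - u'‖)
    (h_eps : 0 < S.eps)
    (h_nonempty : ∃ u ∈ S.inputs, S.eps ≤ ‖u‖)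
    (h_ratio : 0 < S.ratioBound)
    (P : BoxIntegral.Prepartition S.ampBox) (hP : P.IsPartition)
    (D : Set (AENLM.Traj n × AENLM.Traj n)) (hD_fin : D.Finite) (hD_two : D.Nontrivial)
    (hD : ∀ s ∈ D, s.1 ∈ S.inputs ∧ s.2 = S.plant s.1)
    (σ : ℕ → AENLM.State m n) (H : ℕ → AENLM.Rect m) (h_run : S.IsRun P D σ H) :
    IsGreatest S.plantErrors S.aeNLM ∧
    Antitone (AENLM.globalInference σ H) ∧
    (∀ k, S.aeNLM ≤ AENLM.globalInference σ H k) ∧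
    Filter.Tendsto (AENLM.globalInference σ H) Filter.atTop (nhds S.aeNLM) := by
  have hS : S.Admissible := ⟨h_signal.1, h_plant, h_lip_pos, h_lip, h_eps, h_nonempty, h_ratio⟩
  have hgr := hS.isGreatest_aeNLM
  have hanti := AENLM.antitone_globalInference h_run
  have hlow : ∀ k, S.aeNLM ≤ AENLM.globalInference σ H k :=
    fun k => (hS.sound_run hP hD h_run k).aeNLM_le hS (h_run.select k)
  refine ⟨hgr, hanti, hlow, ?_⟩
  rw [Metric.tendsto_atTop]
  intro e he
  obtain ⟨k, hk⟩ := hS.exists_globalInference_lt hP hD h_run he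
  refine ⟨k, fun j hj => ?_⟩
  rw [Real.dist_eq, abs_of_nonneg (sub_nonneg.2 (hlow j))]
  linarith [hanti hj]
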